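/- Let $\Sigma$ be an arbitrary group. A difference ring is a commutative ring with $1$ together with an action of $\Sigma$ by ring automorphisms; a difference field is a difference ring that is a field; a difference homomorphism is a ring homomorphism commuting with the action of $\Sigma$. For a difference ring $A$ and a set $Y$, the ring of difference polynomials $A\{Y\}$ is the polynomial ring over $A$ in the variables $\sigma y$ ($\sigma\in\Sigma$, $y\in Y$), on which $\Sigma$ acts by the given action on the coefficients and by $\tau(\sigma y)=(\tau\sigma)y$; a point $x\in A^Y$ is substituted into a difference polynomial by $\sigma y\mapsto\sigma(x_y)$. An ideal $I$ of a difference ring $A$ is a perfect difference ideal if $\sigma(I)\subseteq I$ for all $\sigma\in\Sigma$ and if, for all $a\in A$, $\sigma_1,\dots,\sigma_n\in\Sigma$ and $k_1,\dots,k_n\in\mathbb N$, the relation $\sigma_1(a)^{k_1}\cdots\sigma_n(a)^{k_n}\in I$ implies $a\in I$. Let $\kappa$ be an infinite cardinal. A difference field $L$ is called $\kappa$-differencly closed if for every set $Y$ with $|Y|\leq\kappa$, every proper perfect difference ideal of $L\{Y\}$ has a common zero in $L^Y$. Theorem. For every group $\Sigma$ and every infinite cardinal $\kappa$, every difference field $K$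 can be embedded, by an injective difference homomorphism, into a $\kappa$-differencly closed difference field $L$. -/

import Mathlib

universe u v w

/-- The ring `A{Y}` of difference polynomials over a `G`-ring `A` in the indeterminates `Y`:
the polynomial ring over `A` in the variables `g y`, for `g` in `G` and `y` in `Y`
(encoded as pairs `(g, y)`). It is a type synonym, so that `G` does not act through
coefficients only. -/
def DiffPoly (G : Type v) (Y : Type w) (A : Type u) [CommRing A] : Type (max u v w) :=
  MvPolynomial (G × Y) A

namespace DiffPoly

variable {G : Type v} {Y : Type w} {A : Type u} [CommRing A]

noncomputable instance instCommRing : CommRing (DiffPoly G Y A) :=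
  inferInstanceAs (CommRing (MvPolynomial (G × Y) A))

/-- The coefficient embedding of `A` into `A{Y}`. -/
noncomputable def C : A →+* DiffPoly G Y A :=
  (MvPolynomial.C : A →+* MvPolynomial (G × Y) A)

/-- The variable `g y` of `A{Y}`. -/
noncomputable def X (g : G) (y : Y) : DiffPoly G Y A :=
  (MvPolynomial.X (g, y) : MvPolynomial (G × Y) A)

theorem hom_ext {B : Type*} [CommRing B] {φ ψ : DiffPoly G Y A →+* B}
    (hC : ∀ a, φ (C a) = ψ (C a)) (hX : ∀ g y, φ (X g y) = ψ (X g y)) : φ = ψ :=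
  MvPolynomial.ringHom_ext (R := A) (σ := G × Y) hC fun p => hX p.1 p.2

variable [Group G] [MulSemiringAction G A]

/-- The endomorphism of `A{Y}` by which `g` acts: `a` goes to `g • a` for coefficients `a`,
and the variable `h y` goes to `(g * h) y`. -/
noncomputable def act (g : G) : DiffPoly G Y A →+* DiffPoly G Y A :=
  MvPolynomial.eval₂Hom ((C : A →+* DiffPoly G Y A).comp (MulSemiringAction.toRingHom G A g))
    (fun p : G × Y => (X (g * p.1) p.2 : DiffPoly G Y A))

theorem act_C (g : G) (a : A) : act g (C a : DiffPoly G Y A) = C (g • a) :=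
  MvPolynomial.eval₂Hom_C _ _ _

theorem act_X (g h : G) (y : Y) : act g (X h y : DiffPoly G Y A) = X (g * h) y :=
  MvPolynomial.eval₂Hom_X' _ _ _

theorem act_one : act (1 : G) = RingHom.id (DiffPoly G Y A) :=
  hom_ext (fun a => by rw [act_C, one_smul, RingHom.id_apply])
    (fun h y => by rw [act_X, one_mul, RingHom.id_apply])

theorem act_mul (g h : G) :
    act (g * h) = (act g).comp (act h : DiffPoly G Y A →+* DiffPoly G Y A) :=
  hom_ext (fun a => by rw [RingHom.comp_apply, act_C, act_C, act_C, mul_smul])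
    (fun k y => by rw [RingHom.comp_apply, act_X, act_X, act_X, mul_assoc])

noncomputable instance instMulSemiringAction : MulSemiringAction G (DiffPoly G Y A) where
  smul g f := act g f
  one_smul f := congrArg (fun φ : DiffPoly G Y A →+* DiffPoly G Y A => φ f) act_one
  mul_smul g h f :=
    congrArg (fun φ : DiffPoly G Y A →+* DiffPoly G Y A => φ f) (act_mul g h)
  smul_zero g := map_zero (act g)
  smul_add g := map_add (act g)
  smul_one g := map_one (act g)
  smul_mul g := map_mul (act g)

/-- Substitution of the point `x` of the affine space `A^Y` into difference polynomials:
the variable `g y` takes the value `g • x y`. -/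
noncomputable def eval (x : Y → A) : DiffPoly G Y A →+* A :=
  MvPolynomial.eval (fun p : G × Y => p.1 • x p.2)

/-- The set `V(E)` of common zeros of `E` in the affine space `A^Y`. -/
def zeroLocus (E : Set (DiffPoly G Y A)) : Set (Y → A) :=
  {x | ∀ f ∈ E, eval x f = 0}

end DiffPoly

/-- A perfect difference ideal of a `G`-ring: an ideal stable under `G` which contains `a`
as soon as it contains a product of powers of transforms of `a`. -/
structure IsPerfectDiffIdeal (G : Type v) {A : Type u} [Group G] [CommRing A]
    [MulSemiringAction G A] (I : Ideal A) : Prop where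
  smul_mem : ∀ (g : G) (a : A), a ∈ I → g • a ∈ I
  mem_of_prod_mem : ∀ (a : A) (n : ℕ) (g : Fin n → G) (k : Fin n → ℕ),
    (∏ i, (g i • a) ^ k i) ∈ I → a ∈ I

/-- The `G`-field `K` is `κ`-differencly closed: for every set `Y` of at most `κ`
indeterminates, every proper perfect difference ideal of `K{Y}` has a common zero in `K^Y`. -/
def IsDifferenclyClosed (G : Type v) (κ : Cardinal.{w}) (K : Type u) [Group G] [Field K]
    [MulSemiringAction G K] : Prop :=
  ∀ Y : Type w, Cardinal.mk Y ≤ κ → ∀ I : Ideal (DiffPoly G Y K),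
    IsPerfectDiffIdeal G I → I ≠ ⊤ →
      (DiffPoly.zeroLocus (I : Set (DiffPoly G Y K))).Nonempty

/-!
The differencly closed field is obtained in one step, by a Henkin construction inside a single
ring of difference polynomials, instead of by a transfinite tower of extensions.

Two algebraic facts carry the proof. A maximal proper perfect difference ideal is prime
(`IsPerfectDiffIdeal.isPrime_of_maximal`), so a set of elements of a `G`-ring lies in a proper
perfect difference ideal exactly when an equivariant homomorphism to a `G`-field kills it; such
sets are called consistent. And consistency has finite character
(`isDiffConsistent_iUnion_of_directed`), so along a well-order one can accept conditions greedily,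
each one if it is consistent with those accepted before (`exists_greedy_isDiffConsistent`).

Let `Y` be a set of `κ` indeterminates. By Hilbert's basis theorem, every ideal of `L{Y}` has a
generating family indexed by `Finset (G × Y) × ℕ`, whatever `L` is. Take a cardinal `ν` that bounds
this index set and `K`, and a well-order `W` of type `2 ^ ν`. The ring `K{W × Y}` contains a block
of indeterminates for each `w` in `W`, and there are only `2 ^ ν` systems of equations, indexed as
above, in a nameless block of unknowns with coefficients in `K{W × Y}`. A bookkeeping function
assigns a system to each `w` so that each system recurs beyond every bound. If the coefficients of
the system at `w` involve only blocks below `w`, the condition at `w` says that block `w` is a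
solution. The greedy choice gives a consistent union of conditions, and `L` is the field of values
of an equivariant homomorphism `φ` that kills it.

For a proper perfect difference ideal `I` of `L{Y}`, generators of `I`, cleared of denominators,
form such a system. The cofinality of `W` exceeds `ν`, so the coefficients involve only blocks
below some bound, and the system occurs at some `w` beyond it. As `I` has a zero in some `G`-field
over `L`, moving block `w` to this zero shows that the condition at `w` is consistent with the
earlier accepted ones, in which block `w` does not occur (`isDiffConsistent_union_demand`). Hence
it was accepted, and `φ` sends block `w` to a zero of `I` in `L`.
-/

/-! ### Perfect difference ideals -/

section Perfect

variable {G : Type v} [Group G] {A : Type u} [CommRing A] [MulSemiringAction G A]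

namespace IsPerfectDiffIdeal

theorem ker {F : Type*} [Field F] [MulSemiringAction G F] (φ : A →+*[G] F) :
    IsPerfectDiffIdeal G (RingHom.ker (φ : A →+* F)) where
  smul_mem g a ha := by
    rw [RingHom.mem_ker] at ha ⊢
    change φ a = 0 at ha
    change φ (g • a) = 0
    rw [map_smul, ha, smul_zero]
  mem_of_prod_mem a n g k h := by
    rw [RingHom.mem_ker, map_prod] at h
    obtain ⟨i, -, hi⟩ := Finset.prod_eq_zero_iff.1 h
    have h0 : φ ((g i • a) ^ k i) = 0 := hi
    rw [map_pow, map_smul] at h0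
    have h1 := eq_zero_of_pow_eq_zero h0
    exact (smul_eq_zero_iff_eq (g i)).1 h1

theorem comap {B : Type*} [CommRing B] [MulSemiringAction G B] (φ : A →+*[G] B) {I : Ideal B}
    (hI : IsPerfectDiffIdeal G I) : IsPerfectDiffIdeal G (I.comap (φ : A →+* B)) where
  smul_mem g a ha := by
    change φ (g • a) ∈ I
    rw [map_smul]
    exact hI.smul_mem g _ ha
  mem_of_prod_mem a n g k h := by
    have h' : φ (∏ i, (g i • a) ^ k i) ∈ I := h
    simp only [map_prod, map_pow, map_smul] at h'
    exact hI.mem_of_prod_mem (φ a) n g k h'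

theorem sInf {s : Set (Ideal A)} (hs : ∀ I ∈ s, IsPerfectDiffIdeal G I) :
    IsPerfectDiffIdeal G (sInf s) where
  smul_mem g a ha := by
    rw [Ideal.mem_sInf] at ha ⊢
    exact fun {I} hI => (hs I hI).smul_mem g a (ha hI)
  mem_of_prod_mem a n g k h := by
    rw [Ideal.mem_sInf] at h ⊢
    exact fun {I} hI => (hs I hI).mem_of_prod_mem a n g k (h hI)

theorem iSup_of_directed {ι : Type*} [Nonempty ι] {I : ι → Ideal A} (hd : Directed (· ≤ ·) I)
    (hI : ∀ i, IsPerfectDiffIdeal G (I i)) : IsPerfectDiffIdeal G (⨆ i, I i) where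
  smul_mem g a ha := by
    obtain ⟨i, hi⟩ := (Submodule.mem_iSup_of_directed I hd).1 ha
    exact (Submodule.mem_iSup_of_directed I hd).2 ⟨i, (hI i).smul_mem g a hi⟩
  mem_of_prod_mem a n g k h := by
    obtain ⟨i, hi⟩ := (Submodule.mem_iSup_of_directed I hd).1 h
    exact (Submodule.mem_iSup_of_directed I hd).2 ⟨i, (hI i).mem_of_prod_mem a n g k hi⟩

/-- In a perfect difference ideal `I`, a product `a * b` may be shuffled: for
`c = a * (g • b)`, the product `c * (g⁻¹ • c)` is a multiple of `a * b`. -/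
theorem mul_smul_mem {I : Ideal A} (hI : IsPerfectDiffIdeal G I) {a b : A} (h : a * b ∈ I)
    (g : G) : a * g • b ∈ I := by
  refine hI.mem_of_prod_mem _ 2 ![1, g⁻¹] ![1, 1] ?_
  have e : ∏ i, (![1, g⁻¹] i • (a * g • b)) ^ (![1, 1] i : ℕ)
      = (g • b * g⁻¹ • a) * (a * b) := by
    simp [Fin.prod_univ_two, smul_mul', smul_smul]
    ring
  rw [e]
  exact I.mul_mem_left _ h

/-- The elements that multiply every transform of `b` into a perfect difference ideal form a
perfect difference ideal. -/
theorem exists_colon {I : Ideal A} (hI : IsPerfectDiffIdeal G I) (b : A) :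
    ∃ J : Ideal A, IsPerfectDiffIdeal G J ∧ ∀ x, x ∈ J ↔ ∀ g : G, x * g • b ∈ I := by
  refine ⟨⨅ g : G, I.colon {g • b}, ⟨fun g a ha => ?_, fun a n g k h => ?_⟩, ?_⟩
  all_goals simp only [Ideal.mem_iInf, Submodule.mem_colon_singleton, smul_eq_mul] at *
  · intro h
    have := hI.smul_mem g _ (ha (g⁻¹ * h))
    rwa [smul_mul', smul_smul, mul_inv_cancel_left] at this
  · intro t
    by_cases hk : ∀ i, k i = 0
    · -- all exponents vanish, so that `h` says that every transform of `b` lies in `I`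
      exact I.mul_mem_left a (by simpa [hk] using h t)
    · push Not at hk
      obtain ⟨j, hj⟩ := hk
      refine hI.mem_of_prod_mem _ n g k ?_
      simp only [smul_mul', mul_pow, Finset.prod_mul_distrib, smul_smul]
      refine I.mem_of_dvd ?_ (h (g j * t))
      exact mul_dvd_mul_left _ ((dvd_pow_self _ hj).trans
        (Finset.dvd_prod_of_mem (fun i => ((g i * t) • b) ^ k i) (Finset.mem_univ j)))
  · simp

/-- A maximal proper perfect difference ideal is prime. -/
theorem isPrime_of_maximal {M : Ideal A} (hM : IsPerfectDiffIdeal G M) (hne : M ≠ ⊤)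
    (hmax : ∀ J : Ideal A, IsPerfectDiffIdeal G J → J ≠ ⊤ → M ≤ J → J = M) : M.IsPrime := by
  refine ⟨hne, fun {a b} hab => or_iff_not_imp_right.2 fun hb => ?_⟩
  obtain ⟨J, hJ, hJm⟩ := hM.exists_colon b
  have hJM : J = M := by
    refine hmax J hJ (fun h => hb ?_) fun x hx => (hJm x).2 fun g => M.mul_mem_right _ hx
    simpa using (hJm 1).1 (h ▸ Submodule.mem_top) 1
  exact hJM ▸ (hJm a).2 (hM.mul_smul_mem hab)

theorem exists_isPrime_ge {I : Ideal A} (hI : IsPerfectDiffIdeal G I) (hne : I ≠ ⊤) :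
    ∃ P : Ideal A, IsPerfectDiffIdeal G P ∧ P.IsPrime ∧ I ≤ P := by
  have hchain : ∀ c ⊆ {J : Ideal A | IsPerfectDiffIdeal G J ∧ J ≠ ⊤}, IsChain (· ≤ ·) c →
      ∀ J ∈ c, ∃ ub ∈ {J : Ideal A | IsPerfectDiffIdeal G J ∧ J ≠ ⊤}, ∀ z ∈ c, z ≤ ub := by
    intro c hc hchain J hJ
    have : Nonempty c := ⟨⟨J, hJ⟩⟩
    have hd : Directed (· ≤ ·) (fun J : c => (J : Ideal A)) := hchain.directedOn.directed_val
    refine ⟨⨆ J : c, (J : Ideal A), ⟨iSup_of_directed hd fun J => (hc J.2).1, ?_⟩,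
      fun J hJ => le_iSup (fun J : c => (J : Ideal A)) ⟨J, hJ⟩⟩
    rw [Ideal.ne_top_iff_one, Submodule.mem_iSup_of_directed _ hd]
    rintro ⟨J, hJ⟩
    exact (Ideal.ne_top_iff_one _).1 (hc J.2).2 hJ
  obtain ⟨M, hIM, hM⟩ := zorn_le_nonempty₀ _ hchain I ⟨hI, hne⟩
  exact ⟨M, hM.prop.1, hM.prop.1.isPrime_of_maximal hM.prop.2
    fun J h h' hle => (hM.eq_of_le ⟨h, h'⟩ hle).symm, hIM⟩

end IsPerfectDiffIdeal

/-- The residue field of a `G`-stable prime ideal is a `G`-field. -/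
theorem exists_residueField (P : Ideal A) [P.IsPrime] (hP : ∀ (g : G) (a : A), a ∈ P → g • a ∈ P) :
    ∃ (F : Type u) (_ : Field F) (_ : MulSemiringAction G F) (φ : A →+*[G] F),
      (∀ a, φ a = 0 ↔ a ∈ P) ∧ ∀ z : F, ∃ a b, φ b ≠ 0 ∧ φ b * z = φ a := by
  have hcomap (g : G) : P = P.comap (MulSemiringAction.toRingHom G A g) := by
    ext a
    refine ⟨hP g a, fun h => ?_⟩
    simpa using hP g⁻¹ _ h
  let m (g : G) : P.ResidueField →+* P.ResidueField :=
    Ideal.ResidueField.map P P (MulSemiringAction.toRingHom G A g) (hcomap g)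
  have hm (g : G) (a : A) : m g (algebraMap A _ a) = algebraMap A _ (g • a) :=
    Ideal.ResidueField.map_algebraMap ..
  have hm1 : m 1 = RingHom.id _ := Ideal.ResidueField.ringHom_ext <| RingHom.ext fun a => by
    simp [hm]
  have hmm (g h : G) : m (g * h) = (m g).comp (m h) :=
    Ideal.ResidueField.ringHom_ext <| RingHom.ext fun a => by simp [hm, mul_smul]
  let act : MulSemiringAction G P.ResidueField :=
    { smul g z := m g z
      one_smul z := congrArg (· z) hm1
      mul_smul g h z := congrArg (· z) (hmm g h)
      smul_zero g := map_zero (m g)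
      smul_add g := map_add (m g)
      smul_one g := map_one (m g)
      smul_mul g := map_mul (m g) }
  let φ : A →+*[G] P.ResidueField :=
    { (algebraMap A P.ResidueField : A →+* P.ResidueField) with
      map_smul' := fun g a => (hm g a).symm }
  have hφ (a : A) : φ a = algebraMap (A ⧸ P) P.ResidueField (Ideal.Quotient.mk P a) := rfl
  refine ⟨P.ResidueField, inferInstance, act, φ, fun a => Ideal.algebraMap_residueField_eq_zero,
    fun z => ?_⟩
  obtain ⟨a, b, hb, rfl⟩ := IsFractionRing.div_surjective (A := A ⧸ P) z
  obtain ⟨a, rfl⟩ := Ideal.Quotient.mk_surjective a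
  obtain ⟨b, rfl⟩ := Ideal.Quotient.mk_surjective b
  have hb' : φ b ≠ 0 := by
    rw [hφ]
    exact IsFractionRing.to_map_ne_zero_of_mem_nonZeroDivisors hb
  exact ⟨a, b, hb', mul_div_cancel₀ _ hb'⟩

variable (G) in
/-- A set of elements of a `G`-ring is consistent if it lies in a proper perfect difference
ideal; equivalently, if some equivariant homomorphism to a `G`-field kills it. -/
def IsDiffConsistent (T : Set A) : Prop :=
  ∃ I : Ideal A, IsPerfectDiffIdeal G I ∧ I ≠ ⊤ ∧ T ⊆ I

theorem isDiffConsistent_of_hom {F : Type*} [Field F] [MulSemiringAction G F] (φ : A →+*[G] F)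
    {T : Set A} (hT : ∀ a ∈ T, φ a = 0) : IsDiffConsistent G T :=
  ⟨_, IsPerfectDiffIdeal.ker φ, RingHom.ker_ne_top _, hT⟩

theorem IsDiffConsistent.exists_hom {T : Set A} (hT : IsDiffConsistent G T) :
    ∃ (F : Type u) (_ : Field F) (_ : MulSemiringAction G F) (φ : A →+*[G] F),
      (∀ a ∈ T, φ a = 0) ∧ ∀ z : F, ∃ a b, φ b ≠ 0 ∧ φ b * z = φ a := by
  obtain ⟨I, hI, hne, hTI⟩ := hT
  obtain ⟨P, hP, hprime, hIP⟩ := hI.exists_isPrime_ge hne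
  obtain ⟨F, _, _, φ, hφ, hz⟩ := exists_residueField P hP.smul_mem
  exact ⟨F, _, _, φ, fun a ha => (hφ a).2 (hIP (hTI ha)), hz⟩

/-- Consistency has finite character, because membership in a perfect closure has. -/
theorem isDiffConsistent_iUnion_of_directed {ι : Type*} [Nonempty ι] {T : ι → Set A}
    (hd : Directed (· ⊆ ·) T) (hT : ∀ i, IsDiffConsistent G (T i)) :
    IsDiffConsistent G (⋃ i, T i) := by
  -- `J i` is the perfect closure of `T i`
  let J (i : ι) : Ideal A := sInf {I | IsPerfectDiffIdeal G I ∧ T i ⊆ I}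
  have hJ (i) : IsPerfectDiffIdeal G (J i) := IsPerfectDiffIdeal.sInf fun I hI => hI.1
  have hTJ (i) : T i ⊆ J i := fun a ha => Ideal.mem_sInf.2 fun {_} hI => hI.2 ha
  have hJd : Directed (· ≤ ·) J := hd.mono_comp (r := (· ⊆ ·)) (g := fun S : Set A =>
    InfSet.sInf {I : Ideal A | IsPerfectDiffIdeal G I ∧ S ⊆ I}) fun S S' h =>
      sInf_le_sInf fun I hI => ⟨hI.1, h.trans hI.2⟩
  refine ⟨⨆ i, J i, IsPerfectDiffIdeal.iSup_of_directed hJd hJ, ?_,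
    Set.iUnion_subset fun i => (hTJ i).trans (le_iSup J i)⟩
  rw [Ideal.ne_top_iff_one, Submodule.mem_iSup_of_directed _ hJd]
  rintro ⟨i, hi⟩
  obtain ⟨I, hI, hne, hTI⟩ := hT i
  exact (Ideal.ne_top_iff_one _).1 hne (Ideal.mem_sInf.1 hi ⟨hI, hTI⟩)

/-- Given a well-ordered family `D` of sets, let `S` accept greedily each `D w` that is
consistent with what has been accepted before. Then the union of all accepted sets is
consistent. -/
theorem exists_greedy_isDiffConsistent {W : Type*} [LinearOrder W] [WellFoundedLT W]
    (h0 : IsDiffConsistent G (∅ : Set A)) (D : W → Set A) :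
    ∃ S : Set W, IsDiffConsistent G (⋃ w ∈ S, D w) ∧
      ∀ w, IsDiffConsistent G ((⋃ v ∈ {v ∈ S | v < w}, D v) ∪ D w) → w ∈ S := by
  let acc : W → Prop := wellFounded_lt.fix fun w acc =>
    IsDiffConsistent G ((⋃ (v) (h : v < w) (_ : acc v h), D v) ∪ D w)
  have hacc (w : W) : acc w ↔ IsDiffConsistent G ((⋃ v ∈ {v | acc v ∧ v < w}, D v) ∪ D w) := by
    have e : acc w = IsDiffConsistent G ((⋃ (v) (h : v < w) (_ : acc v), D v) ∪ D w) :=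
      wellFounded_lt.fix_eq _ w
    rw [e]
    have : (⋃ (v) (h : v < w) (_ : acc v), D v) = ⋃ v ∈ {v | acc v ∧ v < w}, D v := by
      ext a
      simp only [Set.mem_iUnion, Set.mem_ofPred_eq, exists_prop]
      tauto
    rw [this]
  refine ⟨{w | acc w}, ?_, fun w hw => (hacc w).2 hw⟩
  rcases isEmpty_or_nonempty {w | acc w} with he | hn
  · rw [Set.isEmpty_coe_sort.1 he]
    simpa using h0
  · have e : (⋃ w ∈ {w | acc w}, D w)
        = ⋃ w : {w | acc w}, ((⋃ v ∈ {v | acc v ∧ v < w}, D v) ∪ D w) := by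
      apply Set.Subset.antisymm
      · exact Set.iUnion₂_subset fun w hw => Set.subset_iUnion_of_subset ⟨w, hw⟩
          Set.subset_union_right
      · exact Set.iUnion_subset fun w => Set.union_subset
          (Set.iUnion₂_subset fun v hv => Set.subset_biUnion_of_mem (u := D) hv.1)
          (Set.subset_biUnion_of_mem (u := D) w.2)
    rw [e]
    refine isDiffConsistent_iUnion_of_directed (directed_of_isDirected_le fun w w' hle => ?_)
      fun w => (hacc w).1 w.2
    refine Set.union_subset_iff.2 ⟨Set.iUnion₂_subset fun v hv => ?_, ?_⟩
    · exact Set.subset_union_of_subset_left (Set.subset_biUnion_of_mem (u := D)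
        (show v ∈ {v | acc v ∧ v < w'} from ⟨hv.1, hv.2.trans_le hle⟩)) _
    · rcases hle.eq_or_lt with rfl | hlt
      · exact Set.subset_union_right
      · exact Set.subset_union_of_subset_left (Set.subset_biUnion_of_mem (u := D)
          (show (w : W) ∈ {v | acc v ∧ v < w'} from ⟨w.2, hlt⟩)) _

end Perfect

/-! ### Generators of ideals of polynomial rings -/

/-- By Hilbert's basis theorem in finitely many variables, an ideal of a polynomial ring over a
field is generated by a family indexed by the pairs of a finite set of variables and a natural
number. -/
theorem MvPolynomial.exists_span_range_eq {σ : Type v} {k : Type u} [Field k]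
    (I : Ideal (MvPolynomial σ k)) :
    ∃ e : Finset σ × ℕ → MvPolynomial σ k, Ideal.span (Set.range e) = I := by
  let r (s : Finset σ) : MvPolynomial s k →+* MvPolynomial σ k :=
    (MvPolynomial.rename (Subtype.val : s → σ)).toRingHom
  have hfg (s : Finset σ) : ∃ t : Finset (MvPolynomial s k), Ideal.span t = I.comap (r s) :=
    IsNoetherian.noetherian (I.comap (r s))
  choose t ht using hfg
  refine ⟨fun p => r p.1 ((t p.1).toList.getD p.2 0), le_antisymm (Ideal.span_le.2 ?_) ?_⟩
  · rintro _ ⟨⟨s, n⟩, rfl⟩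
    change (t s).toList.getD n 0 ∈ I.comap (r s)
    by_cases hn : n < (t s).toList.length
    · rw [List.getD_eq_getElem _ _ hn, ← ht s]
      exact Ideal.subset_span (Finset.mem_toList.1 (List.getElem_mem hn))
    · rw [List.getD_eq_default _ _ (not_lt.1 hn)]
      exact zero_mem _
  · intro f hf
    obtain ⟨s, q, rfl⟩ := MvPolynomial.exists_finset_rename f
    have hq : q ∈ Ideal.span (t s : Set (MvPolynomial s k)) := by rw [ht]; exact hf
    refine (Ideal.map_le_iff_le_comap.2 ?_) (Ideal.mem_map_of_mem (r s) hq)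
    rw [Ideal.span_le]
    intro g hg
    obtain ⟨n, hn, rfl⟩ := List.getElem_of_mem (Finset.mem_toList.2 hg)
    refine Ideal.subset_span ⟨(s, n), ?_⟩
    exact congrArg (r s) (List.getD_eq_getElem _ _ hn)

/-! ### A long well-order with a bookkeeping function -/

open Cardinal in
/-- Every infinite type `N` gives a well-order of cardinality `2 ^ #N`, of cofinality greater
than `#N` by König's theorem. It lists the elements of each type that is not larger than itself
in such a way that each element recurs beyond every bound. -/
theorem Cardinal.exists_wellOrder_bookkeeping (N : Type u) [Infinite N] :
    ∃ (W : Type u) (_ : LinearOrder W) (_ : WellFoundedLT W),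
      #W = 2 ^ #N ∧
      (∀ {ι : Type v} (f : ι → W), lift.{u} #ι ≤ lift.{v} #N → ∃ b, ∀ i, f i < b) ∧
      ∀ {E : Type u} [Nonempty E], #E ≤ 2 ^ #N →
        ∃ e : W → E, ∀ x b, ∃ w, b < w ∧ e w = x := by
  have hN : ℵ₀ ≤ #N := aleph0_le_mk N
  set c : Cardinal.{u} := 2 ^ #N with hc
  have hcN : ℵ₀ ≤ c := hN.trans (cantor _).le
  have hW : #c.ord.ToType = c := mk_ord_toType c
  refine ⟨c.ord.ToType, inferInstance, inferInstance, hW, fun {ι} f hι => ?_, fun {E} _ hE => ?_⟩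
  · by_contra! hf
    have hcof : IsCofinal (Set.range f) := fun b => by
      obtain ⟨i, hi⟩ := hf b
      exact ⟨f i, ⟨i, rfl⟩, hi⟩
    have h1 : Order.cof c.ord.ToType ≤ #(Set.range f) := Order.cof_le hcof
    have h2 : #N < Order.cof c.ord.ToType := by
      rw [Ordinal.cof_toType]
      exact lt_cof_ord_power hN one_lt_two
    have h3 : lift.{v} #(Set.range f) ≤ lift.{v} #N := mk_range_le_lift.trans hι
    exact (h2.trans_le (h1.trans (lift_le.1 h3))).false
  · have hcard : #(c.ord.ToType × E) = #c.ord.ToType := by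
      rw [mk_prod, lift_id, lift_id, hW]
      exact mul_eq_left hcN hE (mk_ne_zero E)
    obtain ⟨ψ⟩ := Cardinal.eq.1 hcard
    refine ⟨fun w => (ψ.symm w).2, fun x b => ?_⟩
    by_contra! h
    have hle : #c.ord.ToType ≤ #(Set.Iic b) :=
      mk_le_of_injective (f := fun w => (⟨ψ (w, x), by
        by_contra hb
        exact h _ (not_le.1 hb) (by simp)⟩ : Set.Iic b)) fun w w' hww => by
          simpa using hww
    have hIio : #(Set.Iio b) < c :=
      (mk_Iio_lt b (by rw [hW, Ordinal.type_toType])).trans_eq hW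
    have hlt : #(Set.Iic b) < c := by
      have : Set.Iic b = insert b (Set.Iio b) := Set.Iio_insert.symm
      rw [this]
      exact (mk_insert_le).trans_lt (add_lt_of_lt hcN hIio
        (one_lt_aleph0.trans_le hcN))
    exact (hle.trans_lt hlt).ne hW

/-! ### Homomorphisms from rings of difference polynomials -/

namespace DiffPoly

section Lift

variable {G : Type v} [Group G] {Z : Type w} {A : Type u} [CommRing A] [MulSemiringAction G A]
  {B : Type*} [CommRing B] [MulSemiringAction G B]

/-- The coefficient embedding as an equivariant homomorphism. -/
noncomputable def CHom : A →+*[G] DiffPoly G Z A :=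
  { (C : A →+* DiffPoly G Z A) with map_smul' := fun g a => (act_C g a).symm }

omit [Group G] [MulSemiringAction G A] in
@[elab_as_elim]
theorem induction_on {motive : DiffPoly G Z A → Prop} (f : DiffPoly G Z A)
    (C : ∀ a, motive (C a)) (add : ∀ p q, motive p → motive q → motive (p + q))
    (mul_X : ∀ p g z, motive p → motive (p * X g z)) : motive f :=
  MvPolynomial.induction_on (R := A) (σ := G × Z) (motive := motive) f C add
    fun p z => mul_X p z.1 z.2

theorem smul_X (g h : G) (z : Z) : g • (X h z : DiffPoly G Z A) = X (g * h) z :=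
  act_X g h z

/-- The equivariant homomorphism that extends `φ` and sends the indeterminate `z` to `x z`. -/
noncomputable def lift (φ : A →+*[G] B) (x : Z → B) : DiffPoly G Z A →+*[G] B :=
  let ρ : DiffPoly G Z A →+* B := MvPolynomial.eval₂Hom (φ : A →+* B) fun p => p.1 • x p.2
  have hC (a : A) : ρ (C a) = φ a := MvPolynomial.eval₂Hom_C _ _ _
  have hX (g : G) (z : Z) : ρ (X g z) = g • x z := MvPolynomial.eval₂Hom_X' _ _ _
  { ρ with
    map_smul' := fun g f => by
      have h : ρ.comp (act g) = (MulSemiringAction.toRingHom G B g).comp ρ := by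
        refine hom_ext (fun a => ?_) fun k z => ?_
        · simp [act_C, hC]
        · simp [act_X, hX, mul_smul]
      exact congrArg (fun θ : DiffPoly G Z A →+* B => θ f) h }

theorem lift_C (φ : A →+*[G] B) (x : Z → B) (a : A) : lift φ x (C a) = φ a :=
  MvPolynomial.eval₂Hom_C _ _ _

theorem lift_X (φ : A →+*[G] B) (x : Z → B) (g : G) (z : Z) : lift φ x (X g z) = g • x z :=
  MvPolynomial.eval₂Hom_X' _ _ _

theorem lift_id_apply (x : Z → A) (f : DiffPoly G Z A) :
    lift (MulSemiringActionHom.id G) x f = eval x f := rfl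

theorem CHom_apply (a : A) : (CHom : A →+*[G] DiffPoly G Z A) a = C a := rfl

theorem equivariantHom_ext {φ ψ : DiffPoly G Z A →+*[G] B} (hC : ∀ a, φ (C a) = ψ (C a))
    (hX : ∀ z, φ (X 1 z) = ψ (X 1 z)) : φ = ψ := by
  have e : (φ : DiffPoly G Z A →+* B) = (ψ : DiffPoly G Z A →+* B) := by
    refine hom_ext hC fun g z => ?_
    have h : φ (g • X 1 z) = ψ (g • X 1 z) := by rw [map_smul, map_smul, hX]
    rw [smul_X, mul_one] at h
    exact h
  exact MulSemiringActionHom.ext fun f => congrArg (fun θ : DiffPoly G Z A →+* B => θ f) e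

theorem lift_X_one (φ : A →+*[G] B) (x : Z → B) (z : Z) : lift φ x (X 1 z) = x z := by
  rw [lift_X, one_smul]

theorem comp_lift {B' : Type*} [CommRing B'] [MulSemiringAction G B'] (h : B →+*[G] B')
    (φ : A →+*[G] B) (x : Z → B) : h.comp (lift φ x) = lift (h.comp φ) fun z => h (x z) := by
  refine equivariantHom_ext (fun a => ?_) fun z => ?_
  · rw [MulSemiringActionHom.comp_apply, lift_C, lift_C, MulSemiringActionHom.comp_apply]
  · rw [MulSemiringActionHom.comp_apply, lift_X_one, lift_X_one]

theorem comp_lift_apply {B' : Type*} [CommRing B'] [MulSemiringAction G B'] (h : B →+*[G] B')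
    (φ : A →+*[G] B) (x : Z → B) (f : DiffPoly G Z A) :
    h (lift φ x f) = lift (h.comp φ) (fun z => h (x z)) f :=
  DFunLike.congr_fun (comp_lift h φ x) f

/-- The indeterminates of which some transform occurs in `f`. -/
def indets (f : DiffPoly G Z A) : Set Z :=
  {z | ∃ g : G, (g, z) ∈ MvPolynomial.vars (R := A) (σ := G × Z) f}

omit [Group G] [MulSemiringAction G A] in
theorem finite_indets (f : DiffPoly G Z A) : f.indets.Finite :=
  ((MvPolynomial.vars (R := A) (σ := G × Z) f).finite_toSet.image Prod.snd).subset
    fun z ⟨g, h⟩ => ⟨(g, z), h, rfl⟩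

theorem lift_congr {φ : A →+*[G] B} {x x' : Z → B} {f : DiffPoly G Z A}
    (h : ∀ z ∈ f.indets, x z = x' z) : lift φ x f = lift φ x' f :=
  MvPolynomial.eval₂Hom_congr' (p₁ := (f : MvPolynomial (G × Z) A)) rfl
    (fun p hp _ => by rw [h p.2 ⟨p.1, hp⟩]) rfl

end Lift

/-- It is enough to solve systems in a single largest set of indeterminates. -/
theorem _root_.isDifferenclyClosed_of_out {G : Type v} [Group G] {κ : Cardinal.{w}} {L : Type u}
    [Field L] [MulSemiringAction G L]
    (h : ∀ I : Ideal (DiffPoly G κ.out L), IsPerfectDiffIdeal G I → I ≠ ⊤ →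
      (zeroLocus (I : Set (DiffPoly G κ.out L))).Nonempty) :
    IsDifferenclyClosed G κ L := by
  intro Y hY I hI hne
  obtain ⟨j⟩ : Nonempty (Y ↪ κ.out) := by rwa [← Cardinal.le_def, Cardinal.mk_out]
  -- the retraction `L{κ} → L{Y}` kills the superfluous indeterminates
  let ρ : DiffPoly G κ.out L →+*[G] DiffPoly G Y L :=
    lift CHom (Function.extend j (fun y => X 1 y) 0)
  let s : DiffPoly G Y L →+*[G] DiffPoly G κ.out L := lift CHom fun y => X 1 (j y)
  have hs (f : DiffPoly G Y L) : ρ (s f) = f := by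
    have e : ρ.comp s = MulSemiringActionHom.id G := by
      refine equivariantHom_ext (fun a => ?_) fun y => ?_
      · rw [MulSemiringActionHom.comp_apply, lift_C, CHom_apply, lift_C]
        rfl
      · rw [MulSemiringActionHom.comp_apply, lift_X_one, lift_X_one, j.injective.extend_apply]
        rfl
    exact DFunLike.congr_fun e f
  obtain ⟨x, hx⟩ := h _ (hI.comap ρ) (Ideal.comap_ne_top _ hne)
  refine ⟨fun y => x (j y), fun f hf => ?_⟩
  have e : (lift (MulSemiringActionHom.id G) x).comp s
      = lift (MulSemiringActionHom.id G) fun y => x (j y) := by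
    refine equivariantHom_ext (fun a => ?_) fun y => ?_
    · rw [MulSemiringActionHom.comp_apply, lift_C, CHom_apply, lift_C, lift_C]
    · rw [MulSemiringActionHom.comp_apply, lift_X_one, lift_X_one, lift_X_one]
  rw [← lift_id_apply, ← e]
  exact hx (s f) (show ρ (s f) ∈ I by rwa [hs])

theorem exists_span_range_eq {G : Type v} {Y : Type w} {L : Type u} [Field L]
    (I : Ideal (DiffPoly G Y L)) :
    ∃ e : Finset (G × Y) × ℕ → DiffPoly G Y L, Ideal.span (Set.range e) = I :=
  MvPolynomial.exists_span_range_eq (σ := G × Y) I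

section Denominators

variable {G : Type v} [Group G] {K : Type u} [CommRing K] [MulSemiringAction G K]
  {W : Type*} {Y : Type w} {L : Type*} [Field L] [MulSemiringAction G L]

/-- The substitution of the block of indeterminates with number `w` for the nameless block. -/
noncomputable def nameBlock (w : W) : DiffPoly G (Option W × Y) K →+*[G] DiffPoly G (W × Y) K :=
  lift CHom fun p => X 1 (p.1.getD w, p.2)

/-- The specialization of the numbered blocks to elements of `L` according to `φ`; the nameless
block survives as the indeterminates of `L{Y}`. -/
noncomputable def specialize (φ : DiffPoly G (W × Y) K →+*[G] L) :
    DiffPoly G (Option W × Y) K →+*[G] DiffPoly G Y L :=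
  lift (CHom.comp (φ.comp CHom)) fun p => p.1.elim (X 1 p.2) fun v => C (φ (X 1 (v, p.2)))

/-- If `L` consists of fractions of values of `φ`, then each difference polynomial over `L`
becomes the specialization of one over `K` after multiplication by a common denominator. -/
theorem exists_specialize_eq (φ : DiffPoly G (W × Y) K →+*[G] L)
    (hφ : ∀ z : L, ∃ a b, φ b ≠ 0 ∧ φ b * z = φ a) (f : DiffPoly G Y L) :
    ∃ r, φ r ≠ 0 ∧ ∃ q, specialize φ q = C (φ r) * f := by
  let j : DiffPoly G (W × Y) K →+*[G] DiffPoly G (Option W × Y) K :=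
    lift CHom fun p => X 1 (some p.1, p.2)
  have hj (r) : specialize φ (j r) = C (φ r) := by
    have e : (specialize φ).comp j = CHom.comp φ := by
      refine equivariantHom_ext (fun a => ?_) fun p => ?_
      · rw [MulSemiringActionHom.comp_apply, lift_C, CHom_apply, specialize, lift_C]
        rfl
      · rw [MulSemiringActionHom.comp_apply, lift_X_one, specialize, lift_X_one]
        rfl
    exact DFunLike.congr_fun e r
  induction f using induction_on with
  | C z =>
    obtain ⟨a, b, hb, h⟩ := hφ z
    exact ⟨b, hb, j a, by rw [hj, ← h, map_mul]⟩
  | add p q hp hq =>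
    obtain ⟨r, hr, p', hp⟩ := hp
    obtain ⟨s, hs, q', hq⟩ := hq
    refine ⟨r * s, by rw [map_mul]; exact mul_ne_zero hr hs, j s * p' + j r * q', ?_⟩
    rw [map_add, map_mul, map_mul, hj, hj, hp, hq, map_mul, map_mul]
    ring
  | mul_X p g y hp =>
    obtain ⟨r, hr, p', hp⟩ := hp
    refine ⟨r, hr, p' * X g (none, y), ?_⟩
    have hX : specialize φ (X g (none, y)) = X g y := by
      rw [specialize, lift_X]
      exact (smul_X g 1 y).trans (by rw [mul_one])
    rw [map_mul, hp, hX, mul_assoc]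

/-- The values of block `w` under `φ` are a common zero of the specializations of a system as soon
as `φ` kills the system with its nameless block renamed to `w`. -/
theorem eval_specialize
    (φ : DiffPoly G (W × Y) K →+*[G] L) (w : W) (f : DiffPoly G (Option W × Y) K) :
    eval (fun y => φ (X 1 (w, y))) (specialize φ f) = φ (nameBlock w f) := by
  rw [← lift_id_apply, specialize, nameBlock, comp_lift_apply, comp_lift_apply]
  congr 2
  · refine MulSemiringActionHom.ext fun a => ?_
    rw [MulSemiringActionHom.comp_apply, MulSemiringActionHom.comp_apply, CHom_apply, lift_C]
    rfl
  · funext p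
    rcases p with ⟨_ | u, y⟩
    · exact lift_X_one _ _ _
    · exact lift_C _ _ _

end Denominators

end DiffPoly

/-! ### Construction of the differencly closed field -/

open Cardinal in
theorem Cardinal.lift_mk_le_of_injective {α : Type u} {β : Type (max u v)} (f : α → β)
    (hf : Function.Injective f) : Cardinal.lift.{max u v} #α ≤ #β := by
  rw [← mk_uLift]
  exact mk_le_of_injective (hf.comp ULift.down_injective)

open Cardinal in
/-- Over a ring with `2 ^ ν` blocks of indeterminates, where `ν` is infinite and bounds the
coefficient ring and the index set, there are at most `2 ^ ν` systems. -/
theorem DiffPoly.mk_systems_le (G : Type v) (K : Type u) [CommRing K] (Y : Type w)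
    (W : Type (max u v w))
    (hW : #W = 2 ^ #(K ⊕ Finset (G × Y) × ℕ)) :
    #(Finset (G × Y) × ℕ → DiffPoly G (Option W × Y) K) ≤ 2 ^ #(K ⊕ Finset (G × Y) × ℕ) := by
  set N : Type (max u v w) := K ⊕ Finset (G × Y) × ℕ with hNdef
  have hinf : Infinite N := .of_injective (fun n : ℕ => (Sum.inr (∅, n) : N)) fun m n h => by
    exact (Prod.ext_iff.1 (Sum.inr_injective h)).2
  have hN : ℵ₀ ≤ #N := aleph0_le_mk N
  have hNc : #N ≤ 2 ^ #N := (cantor _).le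
  have hc : ℵ₀ ≤ (2 : Cardinal) ^ #N := hN.trans hNc
  have hι : Cardinal.lift.{max u v w} #(Finset (G × Y) × ℕ) ≤ #N :=
    lift_mk_le_of_injective.{max v w, u} Sum.inr Sum.inr_injective
  have hK : Cardinal.lift.{max u v w} #K ≤ #N :=
    lift_mk_le_of_injective.{u, max v w} Sum.inl Sum.inl_injective
  have hGY : Cardinal.lift.{max u v w} #(G × Y) ≤ #N :=
    lift_mk_le_of_injective.{max v w, u} (fun p => Sum.inr ({p}, 0)) fun p q h =>
      Finset.singleton_injective (Prod.ext_iff.1 (Sum.inr_injective h)).1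
  have hvars : #(G × Option W × Y) ≤ 2 ^ #N := by
    have h1 : #(G × Option W × Y) = #((G × Y) × Option W) := mk_congr
      { toFun p := ((p.1, p.2.2), p.2.1)
        invFun p := (p.1.1, p.2, p.1.2)
        left_inv _ := rfl
        right_inv _ := rfl }
    rw [h1, mk_prod, mk_option, hW]
    refine (mul_le_max _ _).trans (max_le (max_le ?_ ?_) hc)
    · exact hGY.trans hNc
    · rw [Cardinal.lift_id'.{max v w, max u v w}]
      exact add_le_of_le hc le_rfl (one_le_aleph0.trans hc)
  have hP : #(DiffPoly G (Option W × Y) K) ≤ 2 ^ #N := by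
    refine MvPolynomial.cardinalMk_le_max_lift.trans (max_le (max_le ?_ ?_) hc)
    · exact hK.trans hNc
    · rw [Cardinal.lift_id'.{u, max u v w}]
      exact hvars
  rw [mk_arrow]
  calc Cardinal.lift.{max v w} #(DiffPoly G (Option W × Y) K)
        ^ Cardinal.lift.{max u v w} #(Finset (G × Y) × ℕ)
      ≤ (2 ^ #N) ^ #N := by
        refine (power_le_power_right ?_).trans (power_le_power_left ?_ hι)
        · rwa [Cardinal.lift_id'.{max v w, max u v w}]
        · exact power_ne_zero _ two_ne_zero
    _ = 2 ^ #N := by rw [← power_mul, mul_eq_self hN]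

namespace DiffPoly

variable {G : Type v} [Group G] {K : Type u} [Field K] [MulSemiringAction G K]
  {W : Type*} [LinearOrder W] {Y : Type w}

/-- A system is admissible at stage `w` if its coefficients only involve blocks of indeterminates
with numbers below `w`. -/
def IsAdmissible {ι : Type*} (w : W) (p : ι → DiffPoly G (Option W × Y) K) : Prop :=
  ∀ i v y, (some v, y) ∈ (p i).indets → v < w

/-- The equations by which the block of indeterminates with number `w` is made a solution of the
system `p`; there are none if `p` is not admissible at stage `w`. -/
def demand {ι : Type*} (w : W) (p : ι → DiffPoly G (Option W × Y) K) :
    Set (DiffPoly G (W × Y) K) :=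
  {f | IsAdmissible w p ∧ ∃ i, f = nameBlock w (p i)}

/-- If a system, admissible at stage `w` and with coefficients specialized by `φ`, has a solution
in some extension of the field of values of `φ`, then its demand is consistent with all earlier
demands that `φ` fulfils: the block with number `w` does not occur in these, and may be moved
to the solution. -/
theorem isDiffConsistent_union_demand {ι : Type*} {L : Type*} [Field L] [MulSemiringAction G L]
    {F : Type*} [Field F] [MulSemiringAction G F]
    (φ : DiffPoly G (W × Y) K →+*[G] L) (ψ : DiffPoly G Y L →+*[G] F)
    (e : W → ι → DiffPoly G (Option W × Y) K) {S : Set W}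
    (hφ : ∀ v ∈ S, ∀ f ∈ demand v (e v), φ f = 0)
    {w : W} (hadm : IsAdmissible w (e w)) (hψ : ∀ i, ψ (specialize φ (e w i)) = 0) :
    IsDiffConsistent G ((⋃ v ∈ {v ∈ S | v < w}, demand v (e v)) ∪ demand w (e w)) := by
  classical
  let θ : L →+*[G] F := ψ.comp CHom
  let χ : DiffPoly G (W × Y) K →+*[G] F := lift (θ.comp (φ.comp CHom))
    fun q => if q.1 = w then ψ (X 1 q.2) else θ (φ (X 1 q))
  have hχ (p : W × Y) : χ (X 1 p) = if p.1 = w then ψ (X 1 p.2) else θ (φ (X 1 p)) :=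
    lift_X_one _ _ _
  have hχC : χ.comp CHom = θ.comp (φ.comp CHom) :=
    MulSemiringActionHom.ext fun a => by
      rw [MulSemiringActionHom.comp_apply, CHom_apply, lift_C]
  refine isDiffConsistent_of_hom χ ?_
  rintro f (hf | ⟨-, i, rfl⟩)
  · obtain ⟨v, ⟨hvS, hvw⟩, hf⟩ := Set.mem_iUnion₂.1 hf
    have h0 := hφ v hvS f hf
    obtain ⟨hv, i, rfl⟩ := hf
    have h1 : χ (nameBlock v (e v i)) = θ (φ (nameBlock v (e v i))) := by
      rw [nameBlock, comp_lift_apply, comp_lift_apply, comp_lift_apply, hχC]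
      refine lift_congr fun p hp => ?_
      have hne : p.1.getD v ≠ w := by
        rcases p with ⟨_ | u, y⟩
        · exact hvw.ne
        · exact ((hv i u y hp).trans hvw).ne
      rw [hχ, if_neg hne]
    rw [h1, h0, map_zero]
  · rw [← hψ i]
    rw [nameBlock, specialize, comp_lift_apply, comp_lift_apply, hχC]
    refine lift_congr fun p hp => ?_
    rcases p with ⟨_ | u, y⟩
    · rw [hχ]
      exact if_pos rfl
    · rw [hχ]
      exact if_neg (hadm i u y hp).ne

end DiffPoly

open DiffPoly Cardinal in
/-- Given a set `Y` of indeterminates, a `G`-field `K` has an extension `L` in which every proper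
perfect difference ideal of `L{Y}` has a zero. -/
theorem exists_zeroLocus_nonempty (G : Type v) [Group G] (Y : Type w) (K : Type u) [Field K]
    [MulSemiringAction G K] :
    ∃ (L : Type (max u v w)) (_ : Field L) (_ : MulSemiringAction G L) (_ : K →+*[G] L),
      ∀ I : Ideal (DiffPoly G Y L), IsPerfectDiffIdeal G I → I ≠ ⊤ →
        (zeroLocus (I : Set (DiffPoly G Y L))).Nonempty := by
  -- systems are indexed by `ι`; there are at most `2 ^ #N` of them, with coefficients in `K{W × Y}`
  let ι : Type (max v w) := Finset (G × Y) × ℕ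
  let N : Type (max u v w) := K ⊕ ι
  have hinf : Infinite N := .of_injective (fun n : ℕ => (Sum.inr (∅, n) : N)) fun m n h => by
    exact (Prod.ext_iff.1 (Sum.inr_injective h)).2
  obtain ⟨W, _, _, hW, hbdd, hbook⟩ := exists_wellOrder_bookkeeping N
  have : Nonempty W := mk_ne_zero_iff.1 (by rw [hW]; exact power_ne_zero _ two_ne_zero)
  obtain ⟨e, he⟩ := hbook (E := ι → DiffPoly G (Option W × Y) K)
    (mk_systems_le G K Y W hW)
  obtain ⟨S, hS, hmax⟩ := exists_greedy_isDiffConsistent (G := G)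
    (A := DiffPoly G (W × Y) K)
    (isDiffConsistent_of_hom (lift (MulSemiringActionHom.id G) 0) (by simp))
    fun w => demand w (e w)
  obtain ⟨L, _, _, φ, hφ, hfrac⟩ := hS.exists_hom
  refine ⟨L, _, _, φ.comp CHom, fun I hI hne => ?_⟩
  have hφ' : ∀ v ∈ S, ∀ f ∈ demand v (e v), φ f = 0 :=
    fun v hv f hf => hφ f (Set.mem_biUnion (t := fun v => demand v (e v)) hv hf)
  obtain ⟨F, _, _, ψ, hψ, -⟩ := IsDiffConsistent.exists_hom (T := (I : Set _))
    ⟨I, hI, hne, subset_rfl⟩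
  obtain ⟨c, hc⟩ := exists_span_range_eq I
  have hcI (i) : c i ∈ I := hc ▸ Ideal.subset_span ⟨i, rfl⟩
  -- the system `p` is the family of generators `c`, cleared of the denominators `φ (r i)`
  choose r hr p hp using fun i => exists_specialize_eq φ hfrac (c i)
  have hbd (i : ι) : ∃ b, ∀ v y, (some v, y) ∈ (p i).indets → v ≤ b := by
    obtain ⟨b, hb⟩ := ((p i).finite_indets.image fun q => q.1.getD (Classical.arbitrary W)).bddAbove
    exact ⟨b, fun v y h => hb ⟨_, h, rfl⟩⟩
  choose b hb using hbd
  obtain ⟨b', hb'⟩ := hbdd b (lift_mk_le'.2 ⟨⟨Sum.inr, Sum.inr_injective⟩⟩)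
  obtain ⟨w, hbw, hw⟩ := he p b'
  have hadm : IsAdmissible w (e w) := by
    rw [hw]
    exact fun i v y h => (hb i v y h).trans_lt ((hb' i).trans hbw)
  have hwS : w ∈ S := hmax w <| isDiffConsistent_union_demand φ ψ e hφ' hadm fun i => by
    rw [hw, hp, map_mul, hψ _ (hcI i), mul_zero]
  refine ⟨fun y => φ (X 1 (w, y)), fun f hf => ?_⟩
  have hle : I ≤ RingHom.ker (eval fun y => φ (X 1 (w, y))) := by
    rw [← hc, Ideal.span_le]
    rintro _ ⟨i, rfl⟩
    have h0 : eval (fun y => φ (X 1 (w, y))) (specialize φ (p i)) = 0 := by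
      rw [eval_specialize]
      exact hφ' w hwS _ ⟨hadm, i, by rw [hw]⟩
    rw [hp, map_mul] at h0
    refine (mul_eq_zero.1 h0).resolve_left ?_
    rw [← lift_id_apply, lift_C]
    exact hr i
  exact hle hf

theorem mainTheorem2 (G : Type v) [Group G] (κ : Cardinal.{w}) (hκ : Cardinal.aleph0 ≤ κ)
    (K : Type u) [Field K] [MulSemiringAction G K] :
    ∃ (L : Type (max u v w)) (_ : Field L) (_ : MulSemiringAction G L) (i : K →+*[G] L),
      Function.Injective i ∧ IsDifferenclyClosed G κ L := by
  obtain ⟨L, _, _, i, hL⟩ := exists_zeroLocus_nonempty G κ.out K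
  exact ⟨L, _, _, i, (i : K →+* L).injective, isDifferenclyClosed_of_out hL⟩
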